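/- Let $\mathcal N=\{1,\dots,n\}$ be a finite set of products, let $\mathcal S$ be a collection of non-empty subsets (assortments) of $\mathcal N$, and let $\mathcal G$ be a partition (grouping) of $\mathcal N$. For $S\in\mathcal S$ let $\Delta_S=\{(x_{i})_{i\in S}: x_{i}\ge 0,\ \sum_{i\in S}x_{i}=1\}$. A choice probability collection is a point $\boldsymbol p=(p_{i,S}: S\in\mathcal S,\ i\in S)$ of $\prod_{S\in\mathcal S}\Delta_S$, and $\mu$ denotes the Lebesgue measure on $\prod_{S\in\mathcal S}\Delta_S$ (of dimension $\sum_{S\in\mathcal S}(|S|-1)$). Let $\mathcal P_{\mathcal G}(\mathcal S)$ be the set of the choice probability collections $\boldsymbol p$ for which there are $\lambda:\mathcal S\to\mathbb R$ and $\boldsymbol\nu\in\mathbb R^n$ such that, for all $S,T\in\mathcal S$, $i\in S$, $j\in T$ with $i$ and $j$ in the same group of $\mathcal G$, $$\lambda(S)-\nu_i>\lambda(T)-\nu_j\ \text{ if } p_{i,S}<p_{j,T},\qquad \lambda(S)-\nu_i=\lambda(T)-\nu_j\ \text{ if } p_{i,S}=p_{j,T}\neq 0 .$$ Let $\mathcal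 P_{\mathrm{APU}}(\mathcal S)$ be the set obtained when these conditions are required for all $S,T\in\mathcal S$, $i\in S$, $j\in T$ (all products in one group). Then $$\mu\big(\mathcal P_{\mathcal G}(\mathcal S)\big)\ \ge\ \mu\big(\mathcal P_{\mathrm{APU}}(\mathcal S)\big)\ >\ 0 .$$ The same holds for the choice probabilities represented by the models themselves. The marginal distribution model with marginals $F_1,\dots,F_n$ (absolutely continuous laws on $\mathbb R$ with finite mean and with a distribution function that is strictly increasing on the support) and deterministic utilities $\boldsymbol\nu\in\mathbb R^n$ yields $\boldsymbol p$ if for every $S\in\mathcal S$ there is a joint law $\theta^*$ with marginals $F_1,\dots,F_n$ that maximizes $\mathbb E_\theta[\max_{i\in S}(\nu_i+\tilde\epsilon_i)]$ over all joint laws $\theta$ of $(\tilde\epsilon_1,\dots,\tilde\epsilon_n)$ with these marginals, and $p_{i,S}=\mathbb P_{\theta^*}(i=\arg\max_{j\in S}(\nu_j+\tilde\epsilon_j))$ for all $i\in S$, where $i=\arg\max$ means that $i$ is the only maximizer. Let $\mathcal R_{\mathcal G}(\mathcal S)$ be the set of the choice probability collections yielded by such a model with $F_i=F_j$ whenever $i$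 and $j$ are in the same group of $\mathcal G$, and $\mathcal R_{\mathrm{APU}}(\mathcal S)$ the set of those yielded by such a model with all marginals identical. Then $$\mu\big(\mathcal R_{\mathcal G}(\mathcal S)\big)\ \ge\ \mu\big(\mathcal R_{\mathrm{APU}}(\mathcal S)\big)\ >\ 0 .$$ (For a set that is not known to be measurable, $\mu$ is the outer measure.) -/

import Mathlib

open MeasureTheory ProbabilityTheory

namespace ChoiceModel

/-- The product-assortment pairs of a collection `𝒮` of assortments of the products
`Fin n`: an assortment `S ∈ 𝒮` together with a product `i ∈ S`. -/
abbrev Pairs {n : ℕ} (𝒮 : Finset (Finset (Fin n))) : Type :=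
  Σ S : 𝒮, {i : Fin n // i ∈ S.1}

/-- Vectors `(p_{i,S} : i ∈ S, S ∈ 𝒮)` of real numbers, with the Euclidean norm. -/
abbrev Data {n : ℕ} (𝒮 : Finset (Finset (Fin n))) : Type :=
  EuclideanSpace ℝ (Pairs 𝒮)

/-- The product of the probability simplexes `Δ_S`, `S ∈ 𝒮`: the choice probability
collections. -/
def simplexes {n : ℕ} (𝒮 : Finset (Finset (Fin n))) : Set (Data 𝒮) :=
  {p | (∀ x, 0 ≤ p x) ∧ ∀ S : 𝒮, ∑ i : {i : Fin n // i ∈ S.1}, p ⟨S, i⟩ = 1}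

/-! ### Lebesgue measure on the product of the simplexes -/

/-- The linear subspace of directions of the affine hull of the product of the simplexes. -/
def directions {n : ℕ} (𝒮 : Finset (Finset (Fin n))) : Submodule ℝ (Data 𝒮) where
  carrier := {v | ∀ S : 𝒮, ∑ i : {i : Fin n // i ∈ S.1}, v ⟨S, i⟩ = 0}
  add_mem' := by
    intro v w hv hw S
    have h1 := hv S
    have h2 := hw S
    simp only [PiLp.add_apply, Finset.sum_add_distrib]
    rw [h1, h2, add_zero]
  zero_mem' := by
    intro S
    simp
  smul_mem' := by
    intro c v hv S
    have h1 := hv S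
    simp only [PiLp.smul_apply, smul_eq_mul, ← Finset.mul_sum]
    rw [h1, mul_zero]

/-- The collection of the uniform distributions on the assortments, a point of the product of the
simplexes when all assortments are non-empty. -/
noncomputable def barycenter {n : ℕ} (𝒮 : Finset (Finset (Fin n))) : Data 𝒮 :=
  WithLp.toLp 2 fun x => ((x.1.1.card : ℝ))⁻¹

/-- Lebesgue measure on the product of the simplexes (each `Δ_S` being a convex body of dimension
`|S| - 1` in its affine hull): the Lebesgue measure of the Euclidean space of directions, moved to
the affine hull of the product and restricted to the product. -/
noncomputable def lebesgue {n : ℕ} (𝒮 : Finset (Finset (Fin n))) : Measure (Data 𝒮) :=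
  (Measure.map (fun v : directions 𝒮 => barycenter 𝒮 + (v : Data 𝒮))
    (stdOrthonormalBasis ℝ (directions 𝒮)).toBasis.addHaar).restrict (simplexes 𝒮)

/-! ### The order conditions -/

/-- The conditions on a choice probability collection `p` with disutilities `lam` of the assortments
and deterministic utilities `ν`, for all pairs `(i, S)`, `(j, T)` whose products are related
by `R`. -/
def OrderConditions {n : ℕ} {𝒮 : Finset (Finset (Fin n))} (R : Fin n → Fin n → Prop)
    (p : Data 𝒮) (lam : 𝒮 → ℝ) (ν : Fin n → ℝ) : Prop :=
  ∀ x y : Pairs 𝒮, R x.2 y.2 →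
    (p x < p y → lam x.1 - ν x.2 > lam y.1 - ν y.2) ∧
    (p x = p y → p x ≠ 0 → lam x.1 - ν x.2 = lam y.1 - ν y.2)

/-- `P_𝒢(𝒮)`: the choice probability collections satisfying the conditions for a grouped marginal
distribution model with the grouping `𝒢` of the products. -/
def groupedSet {n : ℕ} (𝒢 : Finpartition (Finset.univ : Finset (Fin n)))
    (𝒮 : Finset (Finset (Fin n))) : Set (Data 𝒮) :=
  {p | p ∈ simplexes 𝒮 ∧ ∃ (lam : 𝒮 → ℝ) (ν : Fin n → ℝ),
    OrderConditions (fun i j => 𝒢.part i = 𝒢.part j) p lam ν}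

/-- `P_APU(𝒮)`: the choice probability collections satisfying the conditions for all pairs. -/
def apuSet {n : ℕ} (𝒮 : Finset (Finset (Fin n))) : Set (Data 𝒮) :=
  {p | p ∈ simplexes 𝒮 ∧ ∃ (lam : 𝒮 → ℝ) (ν : Fin n → ℝ),
    OrderConditions (fun _ _ => True) p lam ν}

/-! ### The marginal distribution model -/

/-- The admissible marginals: absolutely continuous laws on `ℝ` with finite mean and a distribution
function that is strictly increasing on the support. -/
structure IsMarginal (F : Measure ℝ) : Prop where
  isProbabilityMeasure : IsProbabilityMeasure F
  absolutelyContinuous : F ≪ volume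
  strictMonoOn_cdf : StrictMonoOn (cdf F) F.support
  integrable : Integrable (fun t => t) F

/-- The joint laws of `(ε_1, …, ε_n)` with marginals `F_1, …, F_n`. -/
def jointLaws {n : ℕ} (F : Fin n → Measure ℝ) : Set (Measure (Fin n → ℝ)) :=
  {θ | IsProbabilityMeasure θ ∧ ∀ i, θ.map (fun ε => ε i) = F i}

/-- The expected utility `E_θ[max_{i ∈ S} (ν_i + ε_i)]` of a consumer offered `S ≠ ∅`. -/
noncomputable def expectedUtility {n : ℕ} (ν : Fin n → ℝ) (S : Finset (Fin n))
    (θ : Measure (Fin n → ℝ)) : ℝ :=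
  ∫ ε, (⨆ i : {i : Fin n // i ∈ S}, (ν i + ε i)) ∂θ

/-- The probability `P_θ(i = argmax_{j ∈ S} (ν_j + ε_j))`. -/
noncomputable def choiceProb {n : ℕ} (ν : Fin n → ℝ) (S : Finset (Fin n))
    (θ : Measure (Fin n → ℝ)) (i : Fin n) : ℝ :=
  θ.real {ε | ∀ j ∈ S, j ≠ i → ν j + ε j < ν i + ε i}

/-- The marginal distribution model with marginals `F` and deterministic utilities `ν` yields the
choice probabilities `p`: for each assortment, they are the choice probabilities of a joint law that
maximizes the expected utility over all joint laws with the marginals `F`. -/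
def Yields {n : ℕ} {𝒮 : Finset (Finset (Fin n))} (F : Fin n → Measure ℝ) (ν : Fin n → ℝ)
    (p : Data 𝒮) : Prop :=
  ∀ S : 𝒮, ∃ θ ∈ jointLaws F, IsMaxOn (expectedUtility ν S.1) (jointLaws F) θ ∧
    ∀ i : {i : Fin n // i ∈ S.1}, choiceProb ν S.1 θ i = p ⟨S, i⟩

/-- The choice probability collections represented by a grouped marginal distribution model:
products of the same group of `𝒢` have the same marginal. -/
def groupedRepresentable {n : ℕ} (𝒢 : Finpartition (Finset.univ : Finset (Fin n)))
    (𝒮 : Finset (Finset (Fin n))) : Set (Data 𝒮) :=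
  {p | p ∈ simplexes 𝒮 ∧ ∃ (F : Fin n → Measure ℝ) (ν : Fin n → ℝ),
    (∀ i, IsMarginal (F i)) ∧ (∀ i j, 𝒢.part i = 𝒢.part j → F i = F j) ∧ Yields F ν p}

/-- The choice probability collections represented by a marginal distribution model with identical
marginals. -/
def apuRepresentable {n : ℕ} (𝒮 : Finset (Finset (Fin n))) : Set (Data 𝒮) :=
  {p | p ∈ simplexes 𝒮 ∧ ∃ (F : Measure ℝ) (ν : Fin n → ℝ),
    IsMarginal F ∧ Yields (fun _ => F) ν p}

end ChoiceModel

/-!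
A collection satisfying the order conditions is represented by identical marginals: the thresholds
`lam S - ν i` are ordered inversely to the probabilities, so an increasing Lipschitz bijection of
the line sends each threshold to `1 - p` (or beyond `1` when `p = 0`), and the law with this
distribution function, cut off at `0` and `1`, exceeds the threshold with probability `p`. On each
assortment these tail probabilities sum to one, so some joint law makes exactly one utility exceed
`lam S`; by weak duality it maximizes the expected utility, and it yields `p`.

The order conditions hold on a set of positive measure: the Luce model with attraction values
`2 ^ 2 ^ i` satisfies them, and by uniqueness of binary expansions all its ties are between
products offered alone. Such ties persist throughout the product of the simplexes and strict
inequalities are stable, so the conditions hold in a neighbourhood of this collection.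
-/

namespace ChoiceModel

/-! ### Monotone interpolation on the line -/

lemma exists_lipschitz_orderIso_eqOn_Iic {b u v : ℝ} (hu : b < u) (hv : b < v) :
    ∃ χ : ℝ ≃o ℝ, (∃ K, LipschitzWith K χ) ∧ Set.EqOn χ id (Set.Iic b) ∧ χ u = v := by
  have hu' : 0 < u - b := sub_pos.2 hu
  have hv' : 0 < v - b := sub_pos.2 hv
  set c : ℝ := (v - b) / (u - b)
  have hc : 0 < c := div_pos hv' hu'
  set f : ℝ → ℝ := fun t => min t b + c * max (t - b) 0
  have hleft : ∀ t ≤ b, f t = t := fun t ht => by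
    simp only [f, min_eq_left ht, max_eq_right (sub_nonpos.2 ht), mul_zero, add_zero]
  have hright : ∀ t, b ≤ t → f t = b + c * (t - b) := fun t ht => by
    simp only [f, min_eq_right ht, max_eq_left (sub_nonneg.2 ht)]
  have hmono : StrictMono f := by
    refine StrictMonoOn.Iic_union_Ici (a := b) (fun s hs t ht hst => ?_) fun s hs t ht hst => ?_
    · rwa [hleft s hs, hleft t ht]
    · rw [hright s hs, hright t ht]
      gcongr
  have hsurj : Function.Surjective f := fun y => by
    rcases le_total y b with hy | hy
    · exact ⟨y, hleft y hy⟩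
    · refine ⟨b + (y - b) / c, ?_⟩
      rw [hright _ (le_add_of_nonneg_right (div_nonneg (sub_nonneg.2 hy) hc.le)),
        add_sub_cancel_left, mul_div_cancel₀ _ hc.ne', add_sub_cancel]
  have hlip : LipschitzWith (1 + ‖c‖₊ * 1) f := by
    refine (LipschitzWith.id.min_const b).add ((lipschitzWith_smul c).comp ?_)
    exact (LipschitzWith.mk_one fun s t => by rw [dist_sub_right]).max_const 0
  refine ⟨hmono.orderIsoOfSurjective f hsurj, ⟨_, hlip⟩, hleft, (hright u hu.le).trans ?_⟩
  rw [div_mul_cancel₀ _ hu'.ne', add_sub_cancel]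

lemma exists_lipschitz_orderIso_eqOn {f : ℝ → ℝ} (s : Finset ℝ) (hf : StrictMonoOn f s) :
    ∃ ψ : ℝ ≃o ℝ, (∃ K, LipschitzWith K ψ) ∧ Set.EqOn ψ f s := by
  induction s using Finset.induction_on_max with
  | empty => exact ⟨OrderIso.refl ℝ, ⟨1, LipschitzWith.id⟩, by simp⟩
  | insert a s ha ih =>
    rw [Finset.coe_insert] at hf ⊢
    obtain ⟨ψ, ⟨K, hK⟩, hψ⟩ := ih (hf.mono (Set.subset_insert a s))
    rcases s.eq_empty_or_nonempty with rfl | hs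
    · refine ⟨OrderIso.addRight (f a - a), ⟨1, ?_⟩, by simp⟩
      exact LipschitzWith.mk_one fun x y => (dist_add_right x y _).le
    · set m := s.max' hs
      have hm : m ∈ s := s.max'_mem hs
      have hψa : f m < ψ a := hψ hm ▸ ψ.strictMono (ha m hm)
      have hfa : f m < f a := hf (.inr hm) (.inl rfl) (ha m hm)
      obtain ⟨χ, ⟨L, hL⟩, hχ, hχa⟩ := exists_lipschitz_orderIso_eqOn_Iic hψa hfa
      refine ⟨ψ.trans χ, ⟨_, hL.comp hK⟩, Set.forall_mem_insert.2 ⟨hχa, fun t ht => ?_⟩⟩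
      have hle : ψ t ≤ f m := hψ hm ▸ ψ.monotone (s.le_max' t ht)
      exact (hχ hle).trans (hψ ht)

lemma exists_lipschitz_orderIso_comp_eq {X : Type*} [Finite X] {a b : X → ℝ}
    (hlt : ∀ x y, a x < a y → b x < b y) (heq : ∀ x y, a x = a y → b x = b y) :
    ∃ ψ : ℝ ≃o ℝ, (∃ K, LipschitzWith K ψ) ∧ ∀ x, ψ (a x) = b x := by
  have hext : ∀ x, Function.extend a b 0 (a x) = b x :=
    Function.FactorsThrough.extend_apply (fun x y => heq x y) 0
  have hmono : StrictMonoOn (Function.extend a b 0) (Set.finite_range a).toFinset := by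
    rw [Set.Finite.coe_toFinset]
    rintro _ ⟨x, rfl⟩ _ ⟨y, rfl⟩ hxy
    rw [hext, hext]
    exact hlt x y hxy
  obtain ⟨ψ, hψ, heqOn⟩ := exists_lipschitz_orderIso_eqOn _ hmono
  exact ⟨ψ, hψ, fun x => (heqOn (by simp)).trans (hext x)⟩

/-! ### Laws with a prescribed quantile function -/

/-- The law of `ψ⁻¹ U` with `U` uniformly distributed on the unit interval: its distribution
function is `ψ`, cut off at `0` and `1`. -/
noncomputable def quantileLaw (ψ : ℝ ≃o ℝ) : Measure ℝ :=
  (volume.restrict (Set.Icc (0 : ℝ) 1)).map ψ.symm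

section QuantileLaw

variable (ψ : ℝ ≃o ℝ)

lemma quantileLaw_apply {A : Set ℝ} (hA : MeasurableSet A) :
    quantileLaw ψ A = volume (ψ.symm ⁻¹' A ∩ Set.Icc 0 1) := by
  have hm : Measurable ψ.symm := ψ.symm.continuous.measurable
  rw [quantileLaw, Measure.map_apply hm hA, Measure.restrict_apply (hm hA)]

instance isProbabilityMeasure_quantileLaw : IsProbabilityMeasure (quantileLaw ψ) :=
  ⟨by simp [quantileLaw_apply ψ MeasurableSet.univ]⟩

lemma quantileLaw_real_Ioi {a : ℝ} (ha : 0 ≤ ψ a) :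
    (quantileLaw ψ).real (Set.Ioi a) = max (1 - ψ a) 0 := by
  have hpre : ψ.symm ⁻¹' Set.Ioi a ∩ Set.Icc 0 1 = Set.Ioc (ψ a) 1 := by
    ext u
    simp only [Set.mem_inter_iff, Set.mem_preimage, Set.mem_Ioi, Set.mem_Icc, Set.mem_Ioc,
      OrderIso.lt_symm_apply]
    exact ⟨fun h => ⟨h.1, h.2.2⟩, fun h => ⟨h.1, ha.trans h.1.le, h.2⟩⟩
  rw [measureReal_def, quantileLaw_apply ψ measurableSet_Ioi, hpre, ← measureReal_def,
    Real.volume_real_Ioc]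

lemma ae_quantileLaw_mem_Icc : ∀ᵐ t ∂quantileLaw ψ, t ∈ Set.Icc (ψ.symm 0) (ψ.symm 1) := by
  refine (ae_map_iff ψ.symm.continuous.aemeasurable measurableSet_Icc).2 ?_
  filter_upwards [ae_restrict_mem measurableSet_Icc] with u hu
  exact ⟨ψ.symm.monotone hu.1, ψ.symm.monotone hu.2⟩

lemma cdf_quantileLaw {t : ℝ} (ht : t ∈ Set.Icc (ψ.symm 0) (ψ.symm 1)) :
    cdf (quantileLaw ψ) t = ψ t := by
  have h0 : 0 ≤ ψ t := ψ.symm_apply_le.1 ht.1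
  have h1 : ψ t ≤ 1 := ψ.le_symm_apply.1 ht.2
  rw [cdf_eq_real, ← Set.compl_Ioi, probReal_compl_eq_one_sub measurableSet_Ioi,
    quantileLaw_real_Ioi ψ h0, max_eq_left (sub_nonneg.2 h1), sub_sub_cancel]

lemma quantileLaw_absolutelyContinuous {K : NNReal} (hψ : LipschitzWith K ψ) :
    quantileLaw ψ ≪ volume := by
  refine Measure.AbsolutelyContinuous.mk fun A hA hA0 => ?_
  have himage : volume (ψ '' A) = 0 := by
    have hle := hψ.hausdorffMeasure_image_le zero_le_one A
    rwa [hausdorffMeasure_real, hA0, mul_zero, nonpos_iff_eq_zero] at hle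
  rw [quantileLaw_apply ψ hA, ← OrderIso.image_eq_preimage_symm]
  exact measure_mono_null Set.inter_subset_left himage

lemma isMarginal_quantileLaw {K : NNReal} (hψ : LipschitzWith K ψ) :
    IsMarginal (quantileLaw ψ) where
  isProbabilityMeasure := inferInstance
  absolutelyContinuous := quantileLaw_absolutelyContinuous ψ hψ
  strictMonoOn_cdf := by
    have hsupp : (quantileLaw ψ).support ⊆ Set.Icc (ψ.symm 0) (ψ.symm 1) :=
      Measure.support_subset_of_isClosed isClosed_Icc (ae_quantileLaw_mem_Icc ψ)
    intro s hs t ht hst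
    rw [cdf_quantileLaw ψ (hsupp hs), cdf_quantileLaw ψ (hsupp ht)]
    exact ψ.strictMono hst
  integrable :=
    Integrable.of_mem_Icc (ψ.symm 0) (ψ.symm 1) measurable_id.aemeasurable
      (ae_quantileLaw_mem_Icc ψ)

end QuantileLaw

/-! ### Couplings under which exactly one event occurs -/

section ExclusiveCoupling

variable {ι : Type*} [DecidableEq ι] {X : ι → Type*} [∀ i, MeasurableSpace (X i)]

/-- The law that the `j`-th coordinate of `exclusiveCoupling` has given that `A i` is the event
that occurs among those indexed by `S`. -/
noncomputable def exclusiveMarginal (μ : ∀ i, Measure (X i)) (A : ∀ i, Set (X i)) (S : Finset ι)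
    (i j : ι) : Measure (X j) :=
  if j = i then (μ j)[|A j] else if j ∈ S then (μ j)[|(A j)ᶜ] else μ j

variable {μ : ∀ i, Measure (X i)} [∀ i, IsProbabilityMeasure (μ i)] {A : ∀ i, Set (X i)}
  {S : Finset ι}

lemma sum_erase_eq_measure_compl (hA : ∀ i, MeasurableSet (A i)) (hsum : ∑ i ∈ S, μ i (A i) = 1)
    {j : ι} (hj : j ∈ S) : ∑ i ∈ S.erase j, μ i (A i) = μ j (A j)ᶜ := by
  refine (ENNReal.add_right_inj (measure_ne_top (μ j) (A j))).1 ?_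
  rw [Finset.add_sum_erase S (fun i => μ i (A i)) hj, hsum, prob_add_prob_compl (hA j)]

lemma isProbabilityMeasure_exclusiveMarginal (hA : ∀ i, MeasurableSet (A i))
    (hsum : ∑ i ∈ S, μ i (A i) = 1) {i : ι} (hi : i ∈ S) (hne : μ i (A i) ≠ 0) (j : ι) :
    IsProbabilityMeasure (exclusiveMarginal μ A S i j) := by
  unfold exclusiveMarginal
  split_ifs with hji hj
  · exact cond_isProbabilityMeasure (hji ▸ hne)
  · refine cond_isProbabilityMeasure fun h0 => hne ?_
    rw [← sum_erase_eq_measure_compl hA hsum hj] at h0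
    exact Finset.sum_eq_zero_iff.1 h0 i (Finset.mem_erase.2 ⟨Ne.symm hji, hi⟩)
  · infer_instance

lemma sum_smul_exclusiveMarginal (hA : ∀ i, MeasurableSet (A i))
    (hsum : ∑ i ∈ S, μ i (A i) = 1) (j : ι) :
    ∑ i ∈ S, μ i (A i) • exclusiveMarginal μ A S i j = μ j := by
  by_cases hj : j ∈ S
  · have hrest : ∀ i ∈ S.erase j, μ i (A i) • exclusiveMarginal μ A S i j =
        μ i (A i) • (μ j)[|(A j)ᶜ] := fun i hi => by
      rw [exclusiveMarginal, if_neg (Finset.ne_of_mem_erase hi).symm, if_pos hj]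
    rw [← Finset.add_sum_erase _ _ hj, Finset.sum_congr rfl hrest, ← Finset.sum_smul,
      sum_erase_eq_measure_compl hA hsum hj, exclusiveMarginal, if_pos rfl]
    ext B -
    simpa only [Measure.add_apply, Measure.smul_apply, smul_eq_mul, mul_comm] using
      cond_add_cond_compl_eq (hA j) (μ j)
  · have hfree : ∀ i ∈ S, μ i (A i) • exclusiveMarginal μ A S i j = μ i (A i) • μ j :=
      fun i hi => by rw [exclusiveMarginal, if_neg (ne_of_mem_of_not_mem hi hj).symm, if_neg hj]
    rw [Finset.sum_congr rfl hfree, ← Finset.sum_smul, hsum, one_smul]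

variable [Fintype ι]

/-- When the probabilities `μ i (A i)`, `i ∈ S`, sum to one: a joint law with marginals `μ i` under
which exactly one of the events `A i`, `i ∈ S`, occurs. An index `i ∈ S` is drawn with probability
`μ i (A i)`, then the coordinates are drawn independently, conditioned on `A i` being the event of
the family that occurs. -/
noncomputable def exclusiveCoupling (μ : ∀ i, Measure (X i)) (A : ∀ i, Set (X i))
    (S : Finset ι) : Measure (∀ i, X i) :=
  ∑ i ∈ S, μ i (A i) • Measure.pi (exclusiveMarginal μ A S i)

lemma map_eval_smul_pi_exclusiveMarginal (hA : ∀ i, MeasurableSet (A i))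
    (hsum : ∑ i ∈ S, μ i (A i) = 1) {i : ι} (hi : i ∈ S) (j : ι) :
    (μ i (A i) • Measure.pi (exclusiveMarginal μ A S i)).map (Function.eval j) =
      μ i (A i) • exclusiveMarginal μ A S i j := by
  rcases eq_or_ne (μ i (A i)) 0 with h0 | hne
  · simp only [h0, zero_smul, Measure.map_zero]
  · have := isProbabilityMeasure_exclusiveMarginal hA hsum hi hne
    rw [Measure.map_smul, (measurePreserving_eval (exclusiveMarginal μ A S i) j).map_eq]

lemma map_eval_exclusiveCoupling (hA : ∀ i, MeasurableSet (A i)) (hsum : ∑ i ∈ S, μ i (A i) = 1)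
    (j : ι) : (exclusiveCoupling μ A S).map (Function.eval j) = μ j := by
  rw [exclusiveCoupling, Measure.map_finset_sum (measurable_pi_apply j).aemeasurable,
    ← sum_smul_exclusiveMarginal hA hsum j]
  exact Finset.sum_congr rfl fun i hi => map_eval_smul_pi_exclusiveMarginal hA hsum hi j

lemma isProbabilityMeasure_exclusiveCoupling (hA : ∀ i, MeasurableSet (A i))
    (hsum : ∑ i ∈ S, μ i (A i) = 1) : IsProbabilityMeasure (exclusiveCoupling μ A S) := by
  obtain ⟨j, -⟩ : S.Nonempty := Finset.nonempty_of_sum_ne_zero (hsum.trans_ne one_ne_zero)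
  have : IsProbabilityMeasure ((exclusiveCoupling μ A S).map (Function.eval j)) := by
    rw [map_eval_exclusiveCoupling hA hsum]
    infer_instance
  exact Measure.isProbabilityMeasure_of_map (Function.eval j)

lemma ae_pi_exclusiveMarginal (hA : ∀ i, MeasurableSet (A i)) (hsum : ∑ i ∈ S, μ i (A i) = 1)
    {i : ι} (hi : i ∈ S) (hne : μ i (A i) ≠ 0) :
    ∀ᵐ ω ∂Measure.pi (exclusiveMarginal μ A S i), ω i ∈ A i ∧ ∀ j ∈ S, j ≠ i → ω j ∉ A j := by
  have := isProbabilityMeasure_exclusiveMarginal hA hsum hi hne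
  have heval : ∀ j, Measure.QuasiMeasurePreserving (Function.eval j)
      (Measure.pi (exclusiveMarginal μ A S i)) (exclusiveMarginal μ A S i j) := fun j =>
    (measurePreserving_eval _ j).quasiMeasurePreserving
  have hself : ∀ᵐ s ∂exclusiveMarginal μ A S i i, s ∈ A i := by
    rw [exclusiveMarginal, if_pos rfl]
    exact ae_cond_mem (hA i)
  have hother : ∀ j ∈ S, j ≠ i → ∀ᵐ s ∂exclusiveMarginal μ A S i j, s ∉ A j := fun j hj hji => by
    rw [exclusiveMarginal, if_neg hji, if_pos hj]
    exact ae_cond_mem (hA j).compl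
  refine ((heval i).ae hself).and (ae_all_iff.2 fun j => ?_)
  simp only [Filter.eventually_imp_distrib_left]
  exact fun hj hji => (heval j).ae (hother j hj hji)

lemma ae_exclusiveCoupling_existsUnique (hA : ∀ i, MeasurableSet (A i))
    (hsum : ∑ i ∈ S, μ i (A i) = 1) :
    ∀ᵐ ω ∂exclusiveCoupling μ A S, ∃! i, i ∈ S ∧ ω i ∈ A i := by
  rw [exclusiveCoupling, ae_finsetSum_measure_iff]
  intro i hi
  rcases eq_or_ne (μ i (A i)) 0 with h0 | hne
  · simp [h0]
  · refine Measure.ae_smul_measure ?_ _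
    filter_upwards [ae_pi_exclusiveMarginal hA hsum hi hne] with ω ⟨hmem, hnot⟩
    exact ⟨i, ⟨hi, hmem⟩, fun j hj => by_contra fun hji => hnot j hj.1 hji hj.2⟩

end ExclusiveCoupling

/-! ### Choice probabilities under an optimal joint law -/

section MarginalDistributionModel

variable {n : ℕ} {F : Fin n → Measure ℝ} {ν : Fin n → ℝ} {S : Finset (Fin n)}
  {θ : Measure (Fin n → ℝ)}

lemma le_iSup_utility (ν ε : Fin n → ℝ) {i : Fin n} (hi : i ∈ S) :
    ν i + ε i ≤ ⨆ j : {j : Fin n // j ∈ S}, (ν j + ε j) :=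
  le_ciSup (f := fun j : {j : Fin n // j ∈ S} => ν j + ε j) (Finite.bddAbove_range _) ⟨i, hi⟩

lemma iSup_utility_le_add_sum_excess (hS : S.Nonempty) (ν ε : Fin n → ℝ) (l : ℝ) :
    ⨆ j : {j : Fin n // j ∈ S}, (ν j + ε j) ≤ l + ∑ i ∈ S, max 0 (ν i + ε i - l) := by
  have : Nonempty {j : Fin n // j ∈ S} := hS.to_subtype
  refine ciSup_le fun j => ?_
  calc ν j + ε j = l + (ν j + ε j - l) := by ring
    _ ≤ l + max 0 (ν j + ε j - l) := by gcongr; exact le_max_right _ _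
    _ ≤ l + ∑ i ∈ S, max 0 (ν i + ε i - l) := by
      gcongr
      exact Finset.single_le_sum (f := fun i => max 0 (ν i + ε i - l))
        (fun _ _ => le_max_left _ _) j.2

lemma iSup_utility_eq_add_sum_excess {ε : Fin n → ℝ} {l : ℝ}
    (h : ∃! i, i ∈ S ∧ l < ν i + ε i) :
    ⨆ j : {j : Fin n // j ∈ S}, (ν j + ε j) = l + ∑ i ∈ S, max 0 (ν i + ε i - l) := by
  obtain ⟨i, ⟨hi, hil⟩, huniq⟩ := h
  refine (iSup_utility_le_add_sum_excess ⟨i, hi⟩ ν ε l).antisymm ?_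
  have hzero : ∀ j ∈ S, j ≠ i → max 0 (ν j + ε j - l) = 0 := fun j hj hji =>
    max_eq_left (sub_nonpos.2 (not_lt.1 fun hjl => hji (huniq j ⟨hj, hjl⟩)))
  rw [Finset.sum_eq_single_of_mem i hi hzero, max_eq_right (sub_nonneg.2 hil.le), add_sub_cancel]
  exact le_iSup_utility ν ε hi

lemma integrable_utility (hF : ∀ i, Integrable (fun t => t) (F i)) (ν : Fin n → ℝ)
    (hθ : θ ∈ jointLaws F) (i : Fin n) : Integrable (fun ε : Fin n → ℝ => ν i + ε i) θ := by
  have := hθ.1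
  have hi := hF i
  rw [← hθ.2 i] at hi
  exact (integrable_const _).add (hi.comp_measurable (measurable_pi_apply i))

lemma integrable_excess (hF : ∀ i, Integrable (fun t => t) (F i)) (ν : Fin n → ℝ) (l : ℝ)
    (hθ : θ ∈ jointLaws F) (i : Fin n) :
    Integrable (fun ε : Fin n → ℝ => max 0 (ν i + ε i - l)) θ := by
  have := hθ.1
  exact (integrable_zero _ _ _).sup ((integrable_utility hF ν hθ i).sub (integrable_const l))

lemma integrable_add_sum_excess (hF : ∀ i, Integrable (fun t => t) (F i)) (ν : Fin n → ℝ)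
    (S : Finset (Fin n)) (l : ℝ) (hθ : θ ∈ jointLaws F) :
    Integrable (fun ε : Fin n → ℝ => l + ∑ i ∈ S, max 0 (ν i + ε i - l)) θ := by
  have := hθ.1
  exact (integrable_const l).add (integrable_finsetSum _ fun i _ => integrable_excess hF ν l hθ i)

lemma integrable_iSup_utility (hF : ∀ i, Integrable (fun t => t) (F i)) (ν : Fin n → ℝ)
    (hS : S.Nonempty) (hθ : θ ∈ jointLaws F) :
    Integrable (fun ε : Fin n → ℝ => ⨆ i : {i : Fin n // i ∈ S}, (ν i + ε i)) θ := by
  have hmeas : Measurable fun ε : Fin n → ℝ => ⨆ i : {i : Fin n // i ∈ S}, (ν i + ε i) :=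
    Measurable.iSup fun i => (measurable_pi_apply i.1).const_add _
  obtain ⟨i, hi⟩ := hS
  exact integrable_of_le_of_le hmeas.aestronglyMeasurable
    (.of_forall fun ε => le_iSup_utility ν ε hi)
    (.of_forall fun ε => iSup_utility_le_add_sum_excess ⟨i, hi⟩ ν ε 0)
    (integrable_utility hF ν hθ i) (integrable_add_sum_excess hF ν S 0 hθ)

lemma integral_add_sum_excess (hF : ∀ i, Integrable (fun t => t) (F i)) (ν : Fin n → ℝ)
    (S : Finset (Fin n)) (l : ℝ) (hθ : θ ∈ jointLaws F) :
    ∫ ε, (l + ∑ i ∈ S, max 0 (ν i + ε i - l)) ∂θ =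
      l + ∑ i ∈ S, ∫ t, max 0 (ν i + t - l) ∂F i := by
  have := hθ.1
  have hint := integrable_excess hF ν l hθ
  rw [integral_add (integrable_const l) (integrable_finsetSum _ fun i _ => hint i),
    integral_finsetSum _ fun i _ => hint i, integral_const, probReal_univ, one_smul]
  congr! 2 with i
  rw [← hθ.2 i, integral_map (measurable_pi_apply i).aemeasurable]
  exact Continuous.aestronglyMeasurable (by fun_prop)

/-- Weak duality: the expectation of `l + ∑ i ∈ S, max 0 (ν i + ε i - l)` depends only on the
marginals, and it bounds the expected utility with equality when the sum has one positive term. -/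
lemma isMaxOn_expectedUtility (hF : ∀ i, Integrable (fun t => t) (F i)) (hS : S.Nonempty)
    {l : ℝ} (hθ : θ ∈ jointLaws F) (hae : ∀ᵐ ε ∂θ, ∃! i, i ∈ S ∧ l < ν i + ε i) :
    IsMaxOn (expectedUtility ν S) (jointLaws F) θ := by
  intro θ' hθ'
  calc expectedUtility ν S θ'
      ≤ ∫ ε, (l + ∑ i ∈ S, max 0 (ν i + ε i - l)) ∂θ' :=
        integral_mono (integrable_iSup_utility hF ν hS hθ')
          (integrable_add_sum_excess hF ν S l hθ')
          fun ε => iSup_utility_le_add_sum_excess hS ν ε l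
    _ = ∫ ε, (l + ∑ i ∈ S, max 0 (ν i + ε i - l)) ∂θ := by
        rw [integral_add_sum_excess hF ν S l hθ', integral_add_sum_excess hF ν S l hθ]
    _ = expectedUtility ν S θ :=
        (integral_congr_ae (hae.mono fun ε hε => iSup_utility_eq_add_sum_excess hε)).symm

lemma choiceProb_eq_measureReal_Ioi {l : ℝ} (hθ : θ ∈ jointLaws F)
    (hae : ∀ᵐ ε ∂θ, ∃! i, i ∈ S ∧ l < ν i + ε i) {i : Fin n} (hi : i ∈ S) :
    choiceProb ν S θ i = (F i).real (Set.Ioi (l - ν i)) := by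
  have hev : {ε : Fin n → ℝ | ∀ j ∈ S, j ≠ i → ν j + ε j < ν i + ε i} =ᵐ[θ]
      (fun ε => ε i) ⁻¹' Set.Ioi (l - ν i) := by
    filter_upwards [hae] with ε ⟨k, ⟨hk, hkl⟩, huniq⟩
    refine propext ⟨fun h => ?_, fun h j hj hji => ?_⟩
    · rcases eq_or_ne k i with rfl | hki
      · exact sub_lt_iff_lt_add'.2 hkl
      · exact sub_lt_iff_lt_add'.2 (hkl.trans (h k hk hki))
    · have hil : l < ν i + ε i := sub_lt_iff_lt_add'.1 h
      have hjl : ν j + ε j ≤ l := not_lt.1 fun hjl =>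
        hji ((huniq j ⟨hj, hjl⟩).trans (huniq i ⟨hi, hil⟩).symm)
      exact hjl.trans_lt hil
  rw [choiceProb, measureReal_congr hev, ← hθ.2 i,
    map_measureReal_apply (measurable_pi_apply i) measurableSet_Ioi]

end MarginalDistributionModel

section Collections

variable {n : ℕ} {𝒮 : Finset (Finset (Fin n))} {p : Data 𝒮}

lemma nonempty_of_mem_simplexes (hp : p ∈ simplexes 𝒮) (S : 𝒮) : S.1.Nonempty := by
  obtain ⟨i, -⟩ := Finset.nonempty_of_sum_ne_zero ((hp.2 S).trans_ne one_ne_zero)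
  exact ⟨i, i.2⟩

lemma apply_le_one_of_mem_simplexes (hp : p ∈ simplexes 𝒮) (x : Pairs 𝒮) : p x ≤ 1 := by
  rw [← hp.2 x.1]
  exact Finset.single_le_sum (f := fun i => p ⟨x.1, i⟩) (fun _ _ => hp.1 _) (Finset.mem_univ x.2)

lemma yields_of_measureReal_Ioi_eq {F : Fin n → Measure ℝ} {lam : 𝒮 → ℝ} {ν : Fin n → ℝ}
    [∀ i, IsProbabilityMeasure (F i)] (hF : ∀ i, Integrable (fun t => t) (F i))
    (hp : p ∈ simplexes 𝒮)
    (htail : ∀ x : Pairs 𝒮, (F x.2).real (Set.Ioi (lam x.1 - ν x.2)) = p x) : Yields F ν p := by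
  intro S
  set A : Fin n → Set ℝ := fun i => Set.Ioi (lam S - ν i)
  have hA : ∀ i, MeasurableSet (A i) := fun i => measurableSet_Ioi
  have hsum : ∑ i ∈ S.1, F i (A i) = 1 := by
    rw [← ENNReal.ofReal_one, ← hp.2 S, ENNReal.ofReal_sum_of_nonneg fun i _ => hp.1 _,
      ← Finset.sum_coe_sort]
    exact Finset.sum_congr rfl fun i _ => by rw [← htail ⟨S, i⟩, ofReal_measureReal]
  have hθ : exclusiveCoupling F A S.1 ∈ jointLaws F :=
    ⟨isProbabilityMeasure_exclusiveCoupling hA hsum, map_eval_exclusiveCoupling hA hsum⟩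
  have hae : ∀ᵐ ε ∂exclusiveCoupling F A S.1, ∃! i, i ∈ S.1 ∧ lam S < ν i + ε i := by
    simpa only [A, Set.mem_Ioi, sub_lt_iff_lt_add'] using ae_exclusiveCoupling_existsUnique hA hsum
  refine ⟨_, hθ, isMaxOn_expectedUtility hF (nonempty_of_mem_simplexes hp S) hθ hae, fun i => ?_⟩
  rw [choiceProb_eq_measureReal_Ioi hθ hae i.2, htail ⟨S, i⟩]

lemma exists_lipschitz_orderIso_of_orderConditions {lam : 𝒮 → ℝ} {ν : Fin n → ℝ}
    (hp : p ∈ simplexes 𝒮) (h : OrderConditions (fun _ _ => True) p lam ν) :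
    ∃ ψ : ℝ ≃o ℝ, (∃ K, LipschitzWith K ψ) ∧ ∀ x : Pairs 𝒮, 0 ≤ ψ (lam x.1 - ν x.2) ∧
      max (1 - ψ (lam x.1 - ν x.2)) 0 = p x := by
  set a : Pairs 𝒮 → ℝ := fun x => lam x.1 - ν x.2
  have hanti : ∀ x y, p x < p y → a y < a x := fun x y => (h x y trivial).1
  have htie : ∀ x y, p x = p y → p x ≠ 0 → a x = a y := fun x y => (h x y trivial).2
  -- Pairs of probability `0` need not have equal thresholds, so `exp` spreads their values out
  -- above `1`.
  set b : Pairs 𝒮 → ℝ := fun x => 1 - p x + if p x = 0 then Real.exp (a x) else 0 with hb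
  have hb_zero : ∀ x, p x = 0 → b x = 1 + Real.exp (a x) := fun x hx => by simp [hb, hx]
  have hb_ne : ∀ x, p x ≠ 0 → b x = 1 - p x := fun x hx => by simp [hb, hx]
  have hb_ge : ∀ x, 1 - p x ≤ b x := fun x =>
    le_add_of_nonneg_right (by split_ifs <;> positivity)
  have hlt : ∀ x y, a x < a y → b x < b y := by
    intro x y hxy
    have hle : p y ≤ p x := not_lt.1 fun hlt => (hanti x y hlt).not_gt hxy
    rcases hle.lt_or_eq with hlt | heq
    · rw [hb_ne x ((hp.1 y).trans_lt hlt).ne']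
      exact (sub_lt_sub_left hlt 1).trans_le (hb_ge y)
    · have hx : p x = 0 := by_contra fun hx => (htie x y heq.symm hx).not_lt hxy
      rw [hb_zero x hx, hb_zero y (heq.trans hx)]
      gcongr
  have heq : ∀ x y, a x = a y → b x = b y := by
    intro x y hxy
    have hpxy : p x = p y := le_antisymm (not_lt.1 fun hlt => (hanti y x hlt).ne hxy)
      (not_lt.1 fun hlt => (hanti x y hlt).ne' hxy)
    simp only [hb, hxy, hpxy]
  obtain ⟨ψ, hψ, hval⟩ := exists_lipschitz_orderIso_comp_eq hlt heq
  refine ⟨ψ, hψ, fun x => ?_⟩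
  rw [hval x]
  refine ⟨(sub_nonneg.2 (apply_le_one_of_mem_simplexes hp x)).trans (hb_ge x), ?_⟩
  by_cases hx : p x = 0
  · rw [hb_zero x hx, hx, sub_add_cancel_left]
    exact max_eq_right (neg_nonpos.2 (Real.exp_pos _).le)
  · rw [hb_ne x hx, sub_sub_cancel]
    exact max_eq_left (hp.1 x)

lemma apuSet_subset_apuRepresentable (𝒮 : Finset (Finset (Fin n))) :
    apuSet 𝒮 ⊆ apuRepresentable 𝒮 := by
  rintro p ⟨hp, lam, ν, h⟩
  obtain ⟨ψ, ⟨K, hK⟩, hval⟩ := exists_lipschitz_orderIso_of_orderConditions hp h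
  have hF : IsMarginal (quantileLaw ψ) := isMarginal_quantileLaw ψ hK
  refine ⟨hp, quantileLaw ψ, ν, hF,
    yields_of_measureReal_Ioi_eq (lam := lam) (fun _ => hF.integrable) hp fun x => ?_⟩
  rw [quantileLaw_real_Ioi ψ (hval x).1, (hval x).2]

lemma apuSet_subset_groupedSet (𝒢 : Finpartition (Finset.univ : Finset (Fin n)))
    (𝒮 : Finset (Finset (Fin n))) : apuSet 𝒮 ⊆ groupedSet 𝒢 𝒮 :=
  fun _ ⟨hp, lam, ν, h⟩ => ⟨hp, lam, ν, fun x y _ => h x y trivial⟩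

lemma apuRepresentable_subset_groupedRepresentable
    (𝒢 : Finpartition (Finset.univ : Finset (Fin n))) (𝒮 : Finset (Finset (Fin n))) :
    apuRepresentable 𝒮 ⊆ groupedRepresentable 𝒢 𝒮 :=
  fun _ ⟨hp, F, ν, hF, h⟩ => ⟨hp, fun _ => F, ν, fun _ => hF, fun _ _ _ => rfl, h⟩

/-! ### Neighbourhoods in the product of the simplexes -/

open Filter Topology in
lemma eventually_lt_of_apply_lt (p : Data 𝒮) :
    ∀ᶠ q in 𝓝 p, ∀ x y, p x < p y → q x < q y := by
  simp only [eventually_all]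
  intro x y hxy
  have hcont : ∀ z, ContinuousAt (fun q : Data 𝒮 => q z) p := fun z =>
    Continuous.continuousAt (by fun_prop)
  exact (hcont x).eventually_lt (hcont y) hxy

open Filter Topology in
lemma apuSet_mem_nhdsWithin {lam : 𝒮 → ℝ} {ν : Fin n → ℝ} (hpos : ∀ x, 0 < p x)
    (h : OrderConditions (fun _ _ => True) p lam ν)
    (hties : ∀ q ∈ simplexes 𝒮, ∀ x y, p x = p y → q x = q y) :
    apuSet 𝒮 ∈ 𝓝[simplexes 𝒮] p := by
  filter_upwards [nhdsWithin_le_nhds (eventually_lt_of_apply_lt p), self_mem_nhdsWithin]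
    with q hlt hq
  refine ⟨hq, lam, ν, fun x y _ => ⟨fun hxy => (h x y trivial).1 ?_, fun hxy _ => ?_⟩⟩
  · rcases lt_trichotomy (p x) (p y) with h' | h' | h'
    · exact h'
    · exact absurd (hties q hq x y h') hxy.ne
    · exact absurd (hlt y x h') hxy.not_gt
  · refine (h x y trivial).2 ?_ (hpos x).ne'
    exact le_antisymm (not_lt.1 fun h' => (hlt y x h').ne' hxy)
      (not_lt.1 fun h' => (hlt x y h').ne hxy)

lemma measurableSet_simplexes (𝒮 : Finset (Finset (Fin n))) : MeasurableSet (simplexes 𝒮) := by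
  simp only [simplexes, Set.ofPred_and, Set.ofPred_forall]
  refine (MeasurableSet.iInter fun x => ?_).inter (MeasurableSet.iInter fun S => ?_)
  · exact measurableSet_le measurable_const (by fun_prop)
  · exact measurableSet_eq_fun (by fun_prop) measurable_const

lemma sum_barycenter {S : 𝒮} (hS : S.1.Nonempty) :
    ∑ i : {i : Fin n // i ∈ S.1}, barycenter 𝒮 ⟨S, i⟩ = 1 := by
  simp [barycenter, hS.ne_empty]

lemma barycenter_add_mem_simplexes_iff (h𝒮 : ∀ S ∈ 𝒮, S.Nonempty) (v : directions 𝒮) :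
    barycenter 𝒮 + (v : Data 𝒮) ∈ simplexes 𝒮 ↔ ∀ x, 0 ≤ (barycenter 𝒮 + (v : Data 𝒮)) x := by
  refine and_iff_left fun S => ?_
  simp only [PiLp.add_apply, Finset.sum_add_distrib, sum_barycenter (h𝒮 S S.2), v.2 S, add_zero]

lemma sub_barycenter_mem_directions (hp : p ∈ simplexes 𝒮) : p - barycenter 𝒮 ∈ directions 𝒮 :=
  fun S => by
    simp only [PiLp.sub_apply, Finset.sum_sub_distrib, hp.2 S,
      sum_barycenter (nonempty_of_mem_simplexes hp S), sub_self]

open Filter Topology in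
lemma lebesgue_pos_of_mem_nhdsWithin (hp : p ∈ simplexes 𝒮) (hpos : ∀ x, 0 < p x)
    {A : Set (Data 𝒮)} (hA : A ∈ 𝓝[simplexes 𝒮] p) : 0 < lebesgue 𝒮 A := by
  obtain ⟨V, hV, hpV, hVA⟩ := mem_nhdsWithin.1 hA
  set f : directions 𝒮 → Data 𝒮 := fun v => barycenter 𝒮 + (v : Data 𝒮)
  have hf : Continuous f := by fun_prop
  set U : Set (Data 𝒮) := V ∩ {q | ∀ x, 0 < q x}
  have hU : IsOpen U := by
    refine hV.inter ?_
    simp only [Set.ofPred_forall]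
    exact isOpen_iInter_of_finite fun x => isOpen_lt continuous_const (by fun_prop)
  have hpU : f ⟨_, sub_barycenter_mem_directions hp⟩ ∈ U := by
    simpa only [f, add_sub_cancel] using ⟨hpV, hpos⟩
  have hpre : f ⁻¹' U ⊆ f ⁻¹' (U ∩ simplexes 𝒮) := fun v hv =>
    ⟨hv, (barycenter_add_mem_simplexes_iff (fun S hS => nonempty_of_mem_simplexes hp ⟨S, hS⟩) v).2
      fun x => (hv.2 x).le⟩
  have hUm : MeasurableSet (U ∩ simplexes 𝒮) :=
    hU.measurableSet.inter (measurableSet_simplexes 𝒮)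
  calc 0 < (stdOrthonormalBasis ℝ (directions 𝒮)).toBasis.addHaar (f ⁻¹' U) :=
        (hU.preimage hf).measure_pos _ ⟨_, hpU⟩
    _ ≤ (stdOrthonormalBasis ℝ (directions 𝒮)).toBasis.addHaar (f ⁻¹' (U ∩ simplexes 𝒮)) :=
        measure_mono hpre
    _ = lebesgue 𝒮 (U ∩ simplexes 𝒮) := by
        rw [lebesgue, Measure.restrict_apply hUm, Set.inter_eq_left.2 Set.inter_subset_right,
          Measure.map_apply hf.measurable hUm]
    _ ≤ lebesgue 𝒮 A := measure_mono fun q hq => hVA ⟨hq.1.1, hq.2⟩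

/-! ### A collection with forced ties only -/

/-- The choice probabilities `u i / ∑ j ∈ S, u j` of Luce's model with the attraction values `u`,
an explicit family in `apuSet` whose ties can be controlled through `u`. -/
noncomputable def luceCollection (𝒮 : Finset (Finset (Fin n))) (u : Fin n → ℝ) : Data 𝒮 :=
  WithLp.toLp 2 fun x => u x.2 / ∑ j ∈ x.1.1, u j

lemma sum_attraction_pos {u : Fin n → ℝ} (hu : ∀ i, 0 < u i) (x : Pairs 𝒮) :
    0 < ∑ j ∈ x.1.1, u j :=
  Finset.sum_pos (fun i _ => hu i) ⟨x.2, x.2.2⟩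

lemma luceCollection_pos {u : Fin n → ℝ} (hu : ∀ i, 0 < u i) (x : Pairs 𝒮) :
    0 < luceCollection 𝒮 u x :=
  div_pos (hu x.2) (sum_attraction_pos hu x)

lemma luceCollection_mem_simplexes (h𝒮 : ∀ S ∈ 𝒮, S.Nonempty) {u : Fin n → ℝ}
    (hu : ∀ i, 0 < u i) : luceCollection 𝒮 u ∈ simplexes 𝒮 := by
  refine ⟨fun x => (luceCollection_pos hu x).le, fun S => ?_⟩
  have hsum : 0 < ∑ j ∈ S.1, u j := Finset.sum_pos (fun i _ => hu i) (h𝒮 S S.2)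
  simp only [luceCollection, ← Finset.sum_div]
  rw [Finset.sum_coe_sort S.1 u, div_self hsum.ne']

lemma orderConditions_luceCollection {u : Fin n → ℝ} (hu : ∀ i, 0 < u i)
    (R : Fin n → Fin n → Prop) :
    OrderConditions R (luceCollection 𝒮 u) (fun S => Real.log (∑ j ∈ S.1, u j))
      fun i => Real.log (u i) := by
  have hlog : ∀ x : Pairs 𝒮, Real.log (∑ j ∈ x.1.1, u j) - Real.log (u x.2) =
      -Real.log (luceCollection 𝒮 u x) := fun x => by
    rw [luceCollection, Real.log_div (hu x.2).ne' (sum_attraction_pos hu x).ne', neg_sub]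
  intro x y _
  rw [hlog x, hlog y]
  exact ⟨fun hxy => neg_lt_neg (Real.log_lt_log (luceCollection_pos hu x) hxy),
    fun hxy _ => by rw [hxy]⟩

lemma two_pow_add_two_pow_eq_iff {a b c d : ℕ} :
    2 ^ a + 2 ^ b = 2 ^ c + 2 ^ d ↔ a = c ∧ b = d ∨ a = d ∧ b = c := by
  refine ⟨fun h => ?_, by rintro (⟨rfl, rfl⟩ | ⟨rfl, rfl⟩) <;> ring⟩
  have hsum : ∀ a b : ℕ, 2 ^ a + 2 ^ b = ∑ e ∈ if a = b then {a + 1} else {a, b}, 2 ^ e := by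
    intro a b
    split_ifs with hab
    · rw [Finset.sum_singleton, hab, pow_succ, mul_two]
    · rw [Finset.sum_pair hab]
  rw [hsum a b, hsum c d] at h
  have hmem : ∀ e, (if a = b then e = a + 1 else e = a ∨ e = b) ↔
      if c = d then e = c + 1 else e = c ∨ e = d := by
    intro e
    have he := Finset.ext_iff.1 (Finset.geomSum_injective le_rfl h) e
    split_ifs at he ⊢ <;> simpa only [Finset.mem_insert, Finset.mem_singleton] using he
  have ha := hmem a
  have hb := hmem b
  have hc := hmem c
  have hd := hmem d
  have hsucc := hmem (a + 1)
  lia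

lemma eq_or_eq_singleton_of_two_pow_mul_sum_eq {i j : Fin n} {S T : Finset (Fin n)}
    (hi : i ∈ S) (hj : j ∈ T)
    (h : 2 ^ 2 ^ (i : ℕ) * ∑ k ∈ T, 2 ^ 2 ^ (k : ℕ) =
      2 ^ 2 ^ (j : ℕ) * ∑ k ∈ S, 2 ^ 2 ^ (k : ℕ)) :
    (S = T ∧ i = j) ∨ (S = {i} ∧ T = {j}) := by
  have hinj : ∀ i : Fin n, Function.Injective fun k : Fin n => 2 ^ (i : ℕ) + 2 ^ (k : ℕ) :=
    fun i k l hkl => Fin.ext (Nat.pow_right_injective le_rfl (Nat.add_left_cancel hkl))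
  -- Both sides are sums of distinct powers of two, so their binary expansions agree.
  have himage : T.image (fun k : Fin n => 2 ^ (i : ℕ) + 2 ^ (k : ℕ)) =
      S.image fun k : Fin n => 2 ^ (j : ℕ) + 2 ^ (k : ℕ) := by
    refine Finset.geomSum_injective le_rfl ?_
    simpa only [Finset.sum_image (hinj _).injOn, pow_add, ← Finset.mul_sum] using h
  rcases eq_or_ne i j with rfl | hij
  · exact .inl ⟨(Finset.image_injective (hinj i) himage).symm, rfl⟩
  · have hexp : ∀ {k l : Fin n}, 2 ^ (j : ℕ) + 2 ^ (k : ℕ) = 2 ^ (i : ℕ) + 2 ^ (l : ℕ) →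
        k = i ∧ l = j := fun hkl => by
      have := two_pow_add_two_pow_eq_iff.1 hkl
      lia
    refine .inr ⟨Finset.eq_singleton_iff_unique_mem.2 ⟨hi, fun k hk => ?_⟩,
      Finset.eq_singleton_iff_unique_mem.2 ⟨hj, fun l hl => ?_⟩⟩
    · obtain ⟨l, -, hl⟩ := Finset.mem_image.1 (himage ▸ Finset.mem_image_of_mem _ hk)
      exact (hexp hl.symm).1
    · obtain ⟨k, -, hk⟩ := Finset.mem_image.1 (himage ▸ Finset.mem_image_of_mem _ hl)
      exact (hexp hk).2

lemma eq_or_eq_singleton_of_luceCollection_eq {x y : Pairs 𝒮}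
    (h : luceCollection 𝒮 (fun i => 2 ^ 2 ^ (i : ℕ)) x =
      luceCollection 𝒮 (fun i => 2 ^ 2 ^ (i : ℕ)) y) :
    x = y ∨ (x.1.1 = {x.2.1} ∧ y.1.1 = {y.2.1}) := by
  have hu : ∀ i : Fin n, (0 : ℝ) < 2 ^ 2 ^ (i : ℕ) := fun i => by positivity
  obtain ⟨⟨S, hS⟩, i, hi⟩ := x
  obtain ⟨⟨T, hT⟩, j, hj⟩ := y
  have hcross := (div_eq_div_iff (sum_attraction_pos hu _).ne' (sum_attraction_pos hu _).ne').1 h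
  refine (eq_or_eq_singleton_of_two_pow_mul_sum_eq hi hj ?_).imp_left ?_
  · beta_reduce at hcross
    exact_mod_cast hcross
  rintro ⟨rfl, rfl⟩
  rfl

lemma apply_eq_one_of_eq_singleton (hp : p ∈ simplexes 𝒮) {x : Pairs 𝒮} (hx : x.1.1 = {x.2.1}) :
    p x = 1 := by
  rw [← hp.2 x.1]
  refine (Fintype.sum_eq_single (f := fun i => p ⟨x.1, i⟩) x.2 fun i hi =>
    absurd (Subtype.ext ?_) hi).symm
  exact Finset.mem_singleton.1 (hx ▸ i.2)

open Topology in
lemma exists_apuSet_mem_nhdsWithin (h𝒮 : ∀ S ∈ 𝒮, S.Nonempty) :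
    ∃ p ∈ simplexes 𝒮, (∀ x, 0 < p x) ∧ apuSet 𝒮 ∈ 𝓝[simplexes 𝒮] p := by
  have hu : ∀ i : Fin n, (0 : ℝ) < 2 ^ 2 ^ (i : ℕ) := fun i => by positivity
  refine ⟨_, luceCollection_mem_simplexes h𝒮 hu, luceCollection_pos hu,
    apuSet_mem_nhdsWithin (luceCollection_pos hu) (orderConditions_luceCollection hu _)
      fun q hq x y hxy => ?_⟩
  rcases eq_or_eq_singleton_of_luceCollection_eq hxy with rfl | ⟨hx, hy⟩
  · rfl
  · rw [apply_eq_one_of_eq_singleton hq hx, apply_eq_one_of_eq_singleton hq hy]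

end Collections

end ChoiceModel

theorem theorem6 (n : ℕ) (𝒮 : Finset (Finset (Fin n))) (h𝒮 : ∀ S ∈ 𝒮, S.Nonempty)
    (𝒢 : Finpartition (Finset.univ : Finset (Fin n))) :
    (ChoiceModel.lebesgue 𝒮 (ChoiceModel.groupedSet 𝒢 𝒮) ≥
        ChoiceModel.lebesgue 𝒮 (ChoiceModel.apuSet 𝒮) ∧
      ChoiceModel.lebesgue 𝒮 (ChoiceModel.apuSet 𝒮) > 0) ∧
    (ChoiceModel.lebesgue 𝒮 (ChoiceModel.groupedRepresentable 𝒢 𝒮) ≥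
        ChoiceModel.lebesgue 𝒮 (ChoiceModel.apuRepresentable 𝒮) ∧
      ChoiceModel.lebesgue 𝒮 (ChoiceModel.apuRepresentable 𝒮) > 0) := by
  obtain ⟨p, hp, hpos, hnhds⟩ := ChoiceModel.exists_apuSet_mem_nhdsWithin h𝒮
  have hapu : 0 < ChoiceModel.lebesgue 𝒮 (ChoiceModel.apuSet 𝒮) :=
    ChoiceModel.lebesgue_pos_of_mem_nhdsWithin hp hpos hnhds
  have hrepr : ChoiceModel.lebesgue 𝒮 (ChoiceModel.apuSet 𝒮) ≤
      ChoiceModel.lebesgue 𝒮 (ChoiceModel.apuRepresentable 𝒮) :=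
    measure_mono (ChoiceModel.apuSet_subset_apuRepresentable 𝒮)
  exact ⟨⟨measure_mono (ChoiceModel.apuSet_subset_groupedSet 𝒢 𝒮), hapu⟩,
    measure_mono (ChoiceModel.apuRepresentable_subset_groupedRepresentable 𝒢 𝒮),
    hapu.trans_le hrepr⟩
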